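/- Let $d\ge 2$ and let $\Lambda=\prod_{i=1}^d[a_i,b_i)\subset\mathbb R^d$ ($a_i<b_i$) be a rectangular box with periodic boundary conditions: for $x,y\in\Lambda$ let $|x-y|$ denote the Euclidean length of the difference modulo $\Lambda$, i.e. $|x-y|=\min_{k\in\mathbb Z^d}\|x-y+(k_i(b_i-a_i))_i\|_2$. Let $\mathcal X_\Lambda$ be the set of all finite subsets of $\Lambda$, and let $L_\Lambda$ be the Lebesgue–Poisson measure on $\mathcal X_\Lambda$, $$L_\Lambda(A)=\sum_{n\ge0}\frac1{n!}\int_{\Lambda^n}1_A(\{x_1,\dots,x_n\})\,dx_1\cdots dx_n .$$ For $X\in\mathcal X_\Lambda$, join two distinct points $x,y\in X$ by an edge if and only if $|x-y|\le1$. The clusters of $X$ are the (vertex sets of the) connected components of this graph, and $k(X)$ is their number. For real $q>0$ and $z>0$ let $\chi_{\Lambda,z,0}$ be the random-cluster measure of the continuum Potts (Widom–Rowlinson) model at temperature $T=0$, i.e. the probability measure on $\mathcal X_\Lambda$ $$\chi_{\Lambda,z,0}(dX)=Z_{\Lambda,z,0}^{-1}\,z^{\#X}q^{k(X)}\,L_\Lambda(dX),$$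 where $Z_{\Lambda,z,0}$ is the normalizing constant. For a cluster $C$ of $X$ let $\Delta_C(X)=\{x\in\Lambda:\ |y-x|>1\text{ for all }y\in X\setminus C\}$ be its free space. For $0<\gamma<1$, the cluster $C$ is called $\gamma$-confined if $\#C\ge2$ and there are no two Borel sets $\Delta_1,\Delta_2\subset\Delta_C(X)$ with $\operatorname{dist}(\Delta_1,\Delta_2)>1$ (distance modulo $\Lambda$) and with Lebesgue measures $|\Delta_1|,|\Delta_2|\ge\frac\gamma2|\Delta_C(X)|$. Let $0<\gamma<1$, $N_0\in\mathbb N$ and $\varepsilon>0$. Then there exists $q_0\ge1$ (depending only on $\Lambda,\gamma,N_0,\varepsilon$) such that for all real $q\ge q_0$ and all $z>0$ $$\chi_{\Lambda,z,0}\big(A^{\rm dis}_\Lambda\cup A^{\rm ord}_\Lambda\big)\ge1-\varepsilon,$$ where $$A^{\rm ord}_\Lambda=\{X\in\mathcal X_\Lambda:\ \text{some cluster }C\text{ of }X\text{ has }\#C\ge N_0\},$$ $$A^{\rm dis}_\Lambda=\{X\in\mathcal X_\Lambda:\ \text{every cluster }C\text{ of }X\text{ satisfies }\#C=1\text{ or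 is }\gamma\text{-confined}\}.$$ -/

import Mathlib

open MeasureTheory Set
open scoped ENNReal

noncomputable section

namespace WidomRowlinson

variable {d : ℕ}

/-- The rectangular box `Λ = ∏ᵢ [aᵢ, bᵢ)` in Euclidean space. -/
def box (a b : Fin d → ℝ) : Set (EuclideanSpace ℝ (Fin d)) :=
  {x | ∀ i, x i ∈ Ico (a i) (b i)}

/-- The vector `(kᵢ (bᵢ - aᵢ))ᵢ` of the lattice of periods of the box. -/
def period (a b : Fin d → ℝ) (k : Fin d → ℤ) : EuclideanSpace ℝ (Fin d) :=
  WithLp.toLp 2 fun i => (k i : ℝ) * (b i - a i)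

/-- The length `|x - y|` of the difference of two points of the box, understood modulo the box. -/
def perDist {a b : Fin d → ℝ} (x y : box a b) : ℝ :=
  ⨅ k : Fin d → ℤ, ‖(x : EuclideanSpace ℝ (Fin d)) - y + period a b k‖

theorem perDist_comm {a b : Fin d → ℝ} (x y : box a b) : perDist x y = perDist y x := by
  unfold perDist
  refine (Equiv.neg (Fin d → ℤ)).iInf_congr fun k => ?_
  rw [← norm_neg]
  congr 1
  ext i
  simp [period]
  ring

/-- The distance of two subsets of the box with respect to `perDist`
(equal to `∞` if one of them is empty). -/
def setDist {a b : Fin d → ℝ} (S T : Set (box a b)) : ℝ≥0∞ :=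
  ⨅ x ∈ S, ⨅ y ∈ T, ENNReal.ofReal (perDist x y)

/-- Lebesgue measure on the box. -/
def lebesgue (a b : Fin d → ℝ) : Measure (box a b) :=
  (volume : Measure (EuclideanSpace ℝ (Fin d))).comap Subtype.val

/-- The space of all finite subsets `X` of the box. (It is a structure of its own, because the
σ-algebra below differs from the one that Mathlib puts on `Finset`.) -/
structure Config (a b : Fin d → ℝ) where
  /-- The set of occupied positions. -/
  points : Finset (box a b)

/-- The configuration `{x₁, …, xₙ}`. -/
def ofTuple {a b : Fin d → ℝ} (n : ℕ) (x : Fin n → box a b) : Config a b :=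
  ⟨(Set.finite_range x).toFinset⟩

/-- A set `A` of configurations is measurable if, for every `n`, the set of all `(x₁, …, xₙ) ∈ Λⁿ`
with `{x₁, …, xₙ} ∈ A` is Borel. -/
instance instMeasurableSpaceConfig (a b : Fin d → ℝ) : MeasurableSpace (Config a b) :=
  ⨅ n : ℕ, MeasurableSpace.map (ofTuple n) inferInstance

/-- The Lebesgue-Poisson measure
`L(A) = ∑ₙ (1 / n!) ∫_{Λⁿ} 1_A({x₁, …, xₙ}) dx₁ ⋯ dxₙ`. -/
def lebesguePoisson (a b : Fin d → ℝ) : Measure (Config a b) :=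
  Measure.sum fun n : ℕ =>
    ((n.factorial : ℝ≥0∞)⁻¹) • (Measure.pi fun _ : Fin n => lebesgue a b).map (ofTuple n)

/-- The graph `(X, E_X)`: distinct points of `X` are joined if and only if their distance modulo
the box is at most `1`. -/
def graph {a b : Fin d → ℝ} (X : Finset (box a b)) : SimpleGraph {x // x ∈ X} where
  Adj x y := x ≠ y ∧ perDist x.1 y.1 ≤ 1
  symm := ⟨fun x y h => ⟨h.1.symm, perDist_comm x.1 y.1 ▸ h.2⟩⟩
  loopless := ⟨fun _ h => h.1 rfl⟩

/-- The number `k(X)` of clusters of `(X, E_X)`. -/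
def numClusters {a b : Fin d → ℝ} (X : Finset (box a b)) : ℕ :=
  Nat.card (graph X).ConnectedComponent

/-- `C` is a cluster of `X`, i.e. the set of vertices of a connected component of `(X, E_X)`. -/
def IsCluster {a b : Fin d → ℝ} (X C : Finset (box a b)) : Prop :=
  ∃ c : (graph X).ConnectedComponent, (C : Set (box a b)) = Subtype.val '' c.supp

/-- The density `z ^ #X * q ^ k(X)`. -/
def weight {a b : Fin d → ℝ} (q z : ℝ) (X : Config a b) : ℝ≥0∞ :=
  ENNReal.ofReal (z ^ X.points.card * q ^ numClusters X.points)

/-- The normalizing constant. -/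
def partitionFunction (a b : Fin d → ℝ) (q z : ℝ) : ℝ≥0∞ :=
  ∫⁻ X, weight q z X ∂(lebesguePoisson a b)

/-- The random-cluster measure `Z⁻¹ z ^ #X q ^ k(X) L(dX)` at temperature `0`. At temperature `0`
the edge set of the random graph is the deterministic set `E_X`, so that the measure is a measure
on configurations `X`. -/
def randomCluster (a b : Fin d → ℝ) (q z : ℝ) : Measure (Config a b) :=
  (partitionFunction a b q z)⁻¹ • (lebesguePoisson a b).withDensity (weight q z)

/-- The set of all points of the box that are connected to `X \ C`. -/
def occupied {a b : Fin d → ℝ} (X C : Finset (box a b)) : Set (box a b) :=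
  {x | ∃ y ∈ (X : Set (box a b)) \ C, perDist y x ≤ 1}

/-- The free space available to `C` in the configuration `X`. -/
def freeSpace {a b : Fin d → ℝ} (X C : Finset (box a b)) : Set (box a b) :=
  (occupied X C)ᶜ

/-- The cluster `C` of `X` is `γ`-confined: it has at least two points, and its free space has no
two Borel subsets at distance `> 1` each of which contains a fraction `γ / 2` of the free volume. -/
def IsConfined {a b : Fin d → ℝ} (γ : ℝ) (X C : Finset (box a b)) : Prop :=
  2 ≤ C.card ∧
    ¬ ∃ S T : Set (box a b), MeasurableSet S ∧ MeasurableSet T ∧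
      S ⊆ freeSpace X C ∧ T ⊆ freeSpace X C ∧ 1 < setDist S T ∧
      ENNReal.ofReal (γ / 2) * lebesgue a b (freeSpace X C) ≤ lebesgue a b S ∧
      ENNReal.ofReal (γ / 2) * lebesgue a b (freeSpace X C) ≤ lebesgue a b T

/-- Some cluster has at least `N₀` points. -/
def ordered (a b : Fin d → ℝ) (N₀ : ℕ) : Set (Config a b) :=
  {X | ∃ C, IsCluster X.points C ∧ N₀ ≤ C.card}

/-- Every cluster is a singleton or `γ`-confined. -/
def disordered (a b : Fin d → ℝ) (γ : ℝ) : Set (Config a b) :=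
  {X | ∀ C, IsCluster X.points C → C.card = 1 ∨ IsConfined γ X.points C}

end WidomRowlinson

end

/-!
If a configuration is neither ordered nor disordered, it has a cluster `C` with `2 ≤ #C < N₀` whose
free space contains two sets at distance `> 1`, each of which takes up at least a fraction `γ / 2`
of it. Resample the points of `C` independently and uniformly in the free space of `C`. The rest of
the configuration is not affected, and with probability at least `(γ / 2) ^ #C` both sets are hit
and none of the new points lies elsewhere. In this case the new points form at least two clusters,
and the weight has increased by a factor of at least `q`.

After the resampling, the new points still form a union of clusters. A cluster contains every point
in a small cell that it meets, and the box is covered by finitely many such cells, say `M`. A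
configuration thus has at most `2 ^ M` unions of clusters, and the resampling produces it in at
most so many ways, whatever its number of points. The probability of being neither ordered nor
disordered is therefore at most `2 ^ M / ((γ / 2) ^ N₀ * q)`.

The number of clusters is treated for tuples of points, which are almost surely injective. This
turns the Lebesgue-Poisson measure into product measures, and the resampling into Tonelli's theorem.
-/

noncomputable section

namespace WidomRowlinson

section Clusters

variable {E ι : Type*} {r : E → E → Prop} {x : ι → E} {p : ι → Prop}

/-- The number of clusters of a family of points, where the indices `i` and `j` are joined if
`r (x i) (x j)`. Clusters are classes of indices, so that `x` need not be injective. -/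
def clusterCount (r : E → E → Prop) (x : ι → E) : ℕ :=
  Nat.card (Quot fun i j => r (x i) (x j))

/-- No point with an index in `p` is joined to a point with an index outside of `p`. -/
def IsSeparated (r : E → E → Prop) (x : ι → E) (p : ι → Prop) : Prop :=
  ∀ i j, r (x i) (x j) → (p i ↔ p j)

/-- The free space left by a family of points: the points that are joined to none of them. -/
def freeOf (r : E → E → Prop) (x : ι → E) : Set E :=
  {u | ∀ i, ¬ r (x i) u}

theorem isSeparated_iff_mem_freeOf [Std.Symm r] :
    IsSeparated r x p ↔ ∀ i, Subtype.restrict p x i ∈ freeOf r (Subtype.restrict (¬ p ·) x) := by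
  refine ⟨fun h i j hji => j.2 ((h _ _ hji).2 i.2), fun h i j hij => ⟨fun hi => ?_, fun hj => ?_⟩⟩
  · by_contra hj
    exact h ⟨i, hi⟩ ⟨j, hj⟩ (symm_of r hij)
  · by_contra hi
    exact h ⟨j, hj⟩ ⟨i, hi⟩ hij

/-- The clusters of a family are those of a separated part together with those of the rest. -/
def IsSeparated.quotSumEquiv [DecidablePred p] (h : IsSeparated r x p) :
    (Quot fun i j : {i // p i} => r (x i) (x j)) ⊕ (Quot fun i j : {i // ¬ p i} => r (x i) (x j)) ≃
      Quot fun i j => r (x i) (x j) where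
  toFun := Sum.elim (Quot.map Subtype.val fun _ _ => id) (Quot.map Subtype.val fun _ _ => id)
  invFun := Quot.lift
    (fun i => if hi : p i then .inl (Quot.mk _ ⟨i, hi⟩) else .inr (Quot.mk _ ⟨i, hi⟩))
    fun i j hij => by
      by_cases hi : p i
      · have hj := (h i j hij).1 hi
        simp only [hi, hj, dif_pos]
        exact congrArg Sum.inl (Quot.sound hij)
      · have hj := mt (h i j hij).2 hi
        simp only [hi, hj, not_false_eq_true, dif_neg]
        exact congrArg Sum.inr (Quot.sound hij)
  left_inv := by rintro (⟨i, hi⟩ | ⟨i, hi⟩) <;> simp [Quot.map, hi]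
  right_inv := by
    rintro ⟨i⟩
    by_cases hi : p i <;> simp [Quot.map, hi]

theorem IsSeparated.clusterCount_add [Finite ι] (h : IsSeparated r x p) :
    clusterCount r (Subtype.restrict p x) + clusterCount r (Subtype.restrict (¬ p ·) x) =
      clusterCount r x := by
  classical
  exact Nat.card_sum.symm.trans (Nat.card_congr h.quotSumEquiv)

theorem clusterCount_le_card [Finite ι] (r : E → E → Prop) (x : ι → E) :
    clusterCount r x ≤ Nat.card ι :=
  Nat.card_le_card_of_surjective _ Quot.mk_surjective

theorem clusterCount_pos [Finite ι] [Nonempty ι] (r : E → E → Prop) (x : ι → E) :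
    0 < clusterCount r x :=
  have : Nonempty (Quot fun i j => r (x i) (x j)) := .map (Quot.mk _) ‹_›
  Nat.card_pos

theorem IsSeparated.two_le_clusterCount [Finite ι] (h : IsSeparated r x p) {i j : ι} (hi : p i)
    (hj : ¬ p j) : 2 ≤ clusterCount r x := by
  have : Nonempty {i // p i} := ⟨⟨i, hi⟩⟩
  have : Nonempty {i // ¬ p i} := ⟨⟨j, hj⟩⟩
  rw [← h.clusterCount_add]
  exact Nat.add_le_add (clusterCount_pos r _) (clusterCount_pos r _)

theorem isSeparated_of_quot {c : Quot fun i j => r (x i) (x j)} (hc : ∀ i, p i ↔ Quot.mk _ i = c) :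
    IsSeparated r x p := by
  intro i j hij
  have : Quot.mk (fun i j => r (x i) (x j)) i = Quot.mk _ j := Quot.sound hij
  rw [hc, hc, this]

theorem clusterCount_restrict_eq_one {c : Quot fun i j => r (x i) (x j)}
    (hc : ∀ i, p i ↔ Quot.mk _ i = c) : clusterCount r (Subtype.restrict p x) = 1 := by
  classical
  refine Nat.card_eq_one_iff_unique.2 ⟨⟨?_⟩, ?_⟩
  · rintro ⟨i⟩ ⟨j⟩
    refine Sum.inl_injective ((isSeparated_of_quot hc).quotSumEquiv.injective ?_)
    exact ((hc i).1 i.2).trans ((hc j).1 j.2).symm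
  · obtain ⟨i, hi⟩ := Quot.exists_rep c
    exact ⟨Quot.mk _ ⟨i, (hc i).2 hi⟩⟩

/-- If the points of each cell are mutually joined, a separated set of indices is determined by
the cells it visits. -/
theorem card_isSeparated_le {τ : Type*} [Fintype τ] {cell : E → τ}
    (hcell : ∀ u v, cell u = cell v → r u v) (x : ι → E) {s : Finset (Finset ι)}
    (hs : ∀ I ∈ s, IsSeparated r x (· ∈ I)) : s.card ≤ 2 ^ Fintype.card τ := by
  classical
  have mem_iff : ∀ I ∈ s, ∀ i, i ∈ I ↔ cell (x i) ∈ I.image fun j => cell (x j) := by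
    refine fun I hI i => ⟨Finset.mem_image_of_mem fun j => cell (x j), fun hi => ?_⟩
    obtain ⟨j, hj, hji⟩ := Finset.mem_image.1 hi
    exact (hs I hI j i (hcell _ _ hji)).1 hj
  rw [← Fintype.card_finset]
  refine Finset.card_le_card_of_injOn (fun I => I.image fun j => cell (x j))
    (fun _ _ => Finset.mem_univ _) fun I hI J hJ hIJ => ?_
  ext i
  rw [mem_iff I hI, mem_iff J hJ, show I.image _ = J.image _ from hIJ]

end Clusters

section Resampling

variable {E ι κ : Type*} [MeasurableSpace E] {r : E → E → Prop}

theorem measurable_joined {Ω : Type*} [MeasurableSpace Ω] {f g : Ω → E}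
    (hr : Measurable fun e : E × E => r e.1 e.2) (hf : Measurable f) (hg : Measurable g) :
    Measurable fun ω => r (f ω) (g ω) :=
  hr.comp (hf.prodMk hg)

theorem measurable_clusterCount [Finite ι] (hr : Measurable fun e : E × E => r e.1 e.2) :
    Measurable fun x : ι → E => clusterCount r x := by
  have joined : Measurable fun (x : ι → E) (i j : ι) => r (x i) (x j) :=
    measurable_pi_lambda _ fun i => measurable_pi_lambda _ fun j =>
      measurable_joined hr (measurable_pi_apply i) (measurable_pi_apply j)
  exact (measurable_of_countable fun s : ι → ι → Prop => Nat.card (Quot s)).comp joined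

theorem measurable_pow_clusterCount [Finite ι] (hr : Measurable fun e : E × E => r e.1 e.2)
    (Q : ℝ≥0∞) : Measurable fun x : ι → E => Q ^ clusterCount r x :=
  (measurable_of_countable fun n : ℕ => Q ^ n).comp (measurable_clusterCount hr)

theorem measurable_isSeparated [Countable ι] (hr : Measurable fun e : E × E => r e.1 e.2)
    (p : ι → Prop) : Measurable fun x : ι → E => IsSeparated r x p :=
  .forall fun i => .forall fun j =>
    .imp (measurable_joined hr (measurable_pi_apply i) (measurable_pi_apply j)) measurable_const

theorem measurable_mem_freeOf [Countable ι] (hr : Measurable fun e : E × E => r e.1 e.2) :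
    Measurable fun yu : (ι → E) × E => yu.2 ∈ freeOf r yu.1 :=
  .forall fun i =>
    .not (measurable_joined hr ((measurable_pi_apply i).comp measurable_fst) measurable_snd)

theorem measurable_forall_mem_freeOf [Countable ι] [Countable κ]
    (hr : Measurable fun e : E × E => r e.1 e.2) :
    Measurable fun cy : (κ → E) × (ι → E) => ∀ j, cy.1 j ∈ freeOf r cy.2 :=
  .forall fun j => (measurable_mem_freeOf hr).comp
    (measurable_snd.prodMk ((measurable_pi_apply j).comp measurable_fst))

/-- The families of points of `D` that form at least two clusters. -/
def splitFamilies (r : E → E → Prop) (κ : Type*) (D : Set E) : Set (κ → E) :=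
  {c | (∀ j, c j ∈ D) ∧ 2 ≤ clusterCount r c}

/-- A family of independent points of `D` forms at least two clusters with probability at least
`g ^ card κ`. This is the measurable consequence of the existence of two large separated parts of
`D` on which the resampling argument relies. -/
def IsSplittable (r : E → E → Prop) (μ : Measure E) (g : ℝ≥0∞) (κ : Type*) [Fintype κ]
    (D : Set E) : Prop :=
  (g * μ D) ^ Fintype.card κ ≤ Measure.pi (fun _ : κ => μ) (splitFamilies r κ D)

/-- The points with an index in `p` form a cluster, and the free space left by the other points
is splittable. -/
def IsSplittableCluster [Fintype ι] (r : E → E → Prop) (μ : Measure E) (g : ℝ≥0∞) (x : ι → E)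
    (p : ι → Prop) [DecidablePred p] : Prop :=
  IsSeparated r x p ∧ clusterCount r (Subtype.restrict p x) = 1 ∧
    IsSplittable r μ g {i // p i} (freeOf r (Subtype.restrict (¬ p ·) x))

variable {μ : Measure E} {g Q : ℝ≥0∞} [Fintype κ]

theorem isSplittable_of_subsets [SigmaFinite μ] [Std.Symm r] [Nontrivial κ] {D S T : Set E}
    (hS : S ⊆ D) (hT : T ⊆ D) (hST : ∀ u ∈ S, ∀ v ∈ T, ¬ r u v) (hgS : g * μ D ≤ μ S)
    (hgT : g * μ D ≤ μ T) : IsSplittable r μ g κ D := by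
  classical
  obtain ⟨i₀, i₁, hne⟩ := exists_pair_ne κ
  let part : κ → Set E := fun i => if i = i₀ then S else T
  have pi_part_subset : univ.pi part ⊆ splitFamilies r κ D := fun c hc => by
    have hc₀ : c i₀ ∈ S := by simpa [part] using hc i₀ (mem_univ _)
    have hc₁ : ∀ i ≠ i₀, c i ∈ T := fun i hi => by simpa [part, hi] using hc i (mem_univ _)
    have separated : IsSeparated r c (· = i₀) := fun i j hij => by
      constructor <;> rintro rfl <;> by_contra hk
      · exact hST _ hc₀ _ (hc₁ _ hk) hij
      · exact hST _ hc₀ _ (hc₁ _ hk) (symm_of r hij)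
    refine ⟨fun i => ?_, separated.two_le_clusterCount rfl hne.symm⟩
    obtain rfl | hi := eq_or_ne i i₀
    exacts [hS hc₀, hT (hc₁ i hi)]
  calc (g * μ D) ^ Fintype.card κ
      = ∏ _i : κ, g * μ D := by simp
    _ ≤ ∏ i, μ (part i) := Finset.prod_le_prod' fun i _ => by
        simp only [part]; split_ifs <;> assumption
    _ = Measure.pi (fun _ => μ) (univ.pi part) := (Measure.pi_pi _ _).symm
    _ ≤ _ := measure_mono pi_part_subset

theorem IsSplittable.lintegral_le [SigmaFinite μ] {D : Set E} (h : IsSplittable r μ g κ D)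
    (hr : Measurable fun e : E × E => r e.1 e.2) (hD : MeasurableSet D) (hQ : 1 ≤ Q) :
    g ^ Fintype.card κ * (Q * ∫⁻ c in {c | (∀ j, c j ∈ D) ∧ clusterCount r c = 1},
      Q ^ clusterCount r c ∂Measure.pi fun _ : κ => μ) ≤
        ∫⁻ c in {c | ∀ j, c j ∈ D}, Q ^ clusterCount r c ∂Measure.pi fun _ : κ => μ := by
  have hclusters := measurable_clusterCount (ι := κ) hr
  have pi_eq : {c : κ → E | ∀ j, c j ∈ D} = univ.pi fun _ => D := by ext; simp
  have hpi : MeasurableSet {c : κ → E | ∀ j, c j ∈ D} := pi_eq ▸ .univ_pi fun _ => hD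
  have volume_eq : Measure.pi (fun _ => μ) {c : κ → E | ∀ j, c j ∈ D} = μ D ^ Fintype.card κ := by
    simp [pi_eq, Measure.pi_pi]
  calc _ ≤ g ^ Fintype.card κ * (Q * (Q * μ D ^ Fintype.card κ)) := by
        gcongr
        refine (setLIntegral_mono' (g := fun _ => Q) (hpi.inter (hclusters (.singleton 1)))
          fun _ hc => (congrArg (Q ^ ·) hc.2 |>.trans (pow_one Q)).le).trans ?_
        rw [setLIntegral_const, ← volume_eq]
        gcongr
        exact fun _ hc => hc.1
    _ = Q ^ 2 * (g * μ D) ^ Fintype.card κ := by ring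
    _ ≤ Q ^ 2 * Measure.pi (fun _ => μ) (splitFamilies r κ D) := by gcongr; exact h
    _ = ∫⁻ _ in splitFamilies r κ D, Q ^ 2 ∂Measure.pi fun _ => μ := (setLIntegral_const ..).symm
    _ ≤ ∫⁻ c in splitFamilies r κ D, Q ^ clusterCount r c ∂Measure.pi fun _ => μ :=
        setLIntegral_mono' (hpi.inter (hclusters measurableSet_Ici))
          fun _ hc => pow_le_pow_right₀ hQ hc.2
    _ ≤ _ := lintegral_mono_set fun _ hc => hc.1

theorem measurable_isSplittable_freeOf [Countable ι] [SigmaFinite μ]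
    (hr : Measurable fun e : E × E => r e.1 e.2) (g : ℝ≥0∞) (κ : Type*) [Fintype κ] :
    Measurable fun y : ι → E => IsSplittable r μ g κ (freeOf r y) := by
  have split : MeasurableSet {yc : (ι → E) × (κ → E) | yc.2 ∈ splitFamilies r κ (freeOf r yc.1)} :=
    Measurable.setOf <| ((measurable_forall_mem_freeOf hr).comp measurable_swap).and
      (measurableSet_setOfPred.1 <|
        measurableSet_le measurable_const ((measurable_clusterCount hr).comp measurable_snd))
  exact measurableSet_setOfPred.1 <| measurableSet_le
    (((measurable_measure_prodMk_left (measurable_mem_freeOf hr).setOf).const_mul g).pow_const _)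
    (measurable_measure_prodMk_left split)

variable [Fintype ι]

theorem measurable_isSplittableCluster [SigmaFinite μ]
    (hr : Measurable fun e : E × E => r e.1 e.2) (g : ℝ≥0∞) (p : ι → Prop) [DecidablePred p] :
    Measurable fun x : ι → E => IsSplittableCluster r μ g x p := by
  have restrict (s : ι → Prop) : Measurable fun x : ι → E => Subtype.restrict s x :=
    measurable_pi_lambda _ fun i => measurable_pi_apply i.1
  refine (measurable_isSeparated hr p).and (.and ?_ ?_)
  · exact measurableSet_setOfPred.1
      (measurableSet_eq_fun ((measurable_clusterCount hr).comp (restrict p)) measurable_const)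
  · exact (measurable_isSplittable_freeOf hr g _).comp (restrict (¬ p ·))

theorem setLIntegral_isSeparated [SigmaFinite μ] [Std.Symm r] {p : ι → Prop} [DecidablePred p]
    (hr : Measurable fun e : E × E => r e.1 e.2) (Q : ℝ≥0∞)
    {P : ({i // p i} → E) → ({i // ¬ p i} → E) → Prop}
    (hP : Measurable fun cy : ({i // p i} → E) × ({i // ¬ p i} → E) => P cy.1 cy.2) :
    ∫⁻ x in {x | IsSeparated r x p ∧ P (Subtype.restrict p x) (Subtype.restrict (¬ p ·) x)},
      Q ^ clusterCount r x ∂Measure.pi (fun _ : ι => μ) =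
        ∫⁻ y, Q ^ clusterCount r y * ∫⁻ c in {c | (∀ i, c i ∈ freeOf r y) ∧ P c y},
          Q ^ clusterCount r c ∂Measure.pi (fun _ => μ) ∂Measure.pi (fun _ => μ) := by
  let e := MeasurableEquiv.piEquivPiSubtypeProd (fun _ : ι => E) p
  let S : Set (({i // p i} → E) × ({i // ¬ p i} → E)) :=
    {cy | (∀ i, cy.1 i ∈ freeOf r cy.2) ∧ P cy.1 cy.2}
  let F : ({i // p i} → E) × ({i // ¬ p i} → E) → ℝ≥0∞ :=
    fun cy => Q ^ clusterCount r cy.2 * Q ^ clusterCount r cy.1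
  have hS : MeasurableSet S := Measurable.setOf ((measurable_forall_mem_freeOf hr).and hP)
  have hF : Measurable F := ((measurable_pow_clusterCount hr Q).comp measurable_snd).mul
    ((measurable_pow_clusterCount hr Q).comp measurable_fst)
  calc _ = ∫⁻ x in e ⁻¹' S, F (e x) ∂Measure.pi (fun _ : ι => μ) := by
        simp only [isSeparated_iff_mem_freeOf]
        refine setLIntegral_congr_fun (e.measurable hS) fun x hx => ?_
        simp only [F]
        rw [← (isSeparated_iff_mem_freeOf.2 hx.1).clusterCount_add, pow_add, mul_comm]
        rfl
    _ = ∫⁻ cy in S, F cy ∂(Measure.pi fun _ => μ).prod (Measure.pi fun _ => μ) :=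
        (measurePreserving_piEquivPiSubtypeProd (fun _ : ι => μ) p).setLIntegral_comp_preimage hS hF
    _ = ∫⁻ y, ∫⁻ c, S.indicator F (c, y) ∂(Measure.pi fun _ => μ) ∂Measure.pi fun _ => μ := by
        rw [← lintegral_indicator hS, lintegral_prod_symm' _ (hF.indicator hS)]
    _ = _ := by
        refine lintegral_congr fun y => ?_
        have hSy : MeasurableSet {c | (∀ i : {i // p i}, c i ∈ freeOf r y) ∧ P c y} :=
          measurable_prodMk_right hS
        rw [← lintegral_const_mul _ (measurable_pow_clusterCount hr Q), ← lintegral_indicator hSy]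
        rfl

/-- Resampling the points of a splittable cluster in their free space costs a factor `g` for each
point and gains a factor `Q` for the additional cluster. -/
theorem lintegral_isSplittableCluster_le [SigmaFinite μ] [Std.Symm r]
    (hr : Measurable fun e : E × E => r e.1 e.2) (g : ℝ≥0∞) (hQ : 1 ≤ Q) (p : ι → Prop)
    [DecidablePred p] :
    g ^ Fintype.card {i // p i} * (Q * ∫⁻ x in {x | IsSplittableCluster r μ g x p},
      Q ^ clusterCount r x ∂Measure.pi fun _ : ι => μ) ≤
        ∫⁻ x in {x | IsSeparated r x p}, Q ^ clusterCount r x ∂Measure.pi fun _ : ι => μ := by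
  have single : Measurable fun cy : ({i // p i} → E) × ({i // ¬ p i} → E) =>
      clusterCount r cy.1 = 1 := measurableSet_setOfPred.1 <|
    measurableSet_eq_fun ((measurable_clusterCount hr).comp measurable_fst) measurable_const
  have resampled := setLIntegral_isSeparated (μ := μ) hr Q (p := p)
    (P := fun _ _ => True) measurable_const
  have split := setLIntegral_isSeparated (μ := μ) hr Q
    (P := fun c y => clusterCount r c = 1 ∧ IsSplittable r μ g {i // p i} (freeOf r y))
    (single.and ((measurable_isSplittable_freeOf (μ := μ) hr g _).comp measurable_snd))
  simp only [and_true] at resampled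
  simp only [IsSplittableCluster]
  rw [resampled, split]
  refine (mul_le_mul_right (lintegral_const_mul_le _ _) _).trans
    ((lintegral_const_mul_le _ _).trans (lintegral_mono fun y => ?_))
  by_cases hy : IsSplittable r μ g {i // p i} (freeOf r y)
  · have hD : MeasurableSet (freeOf r y) :=
      ((measurable_mem_freeOf hr).comp measurable_prodMk_left).setOf
    simp only [hy, and_true]
    rw [mul_left_comm Q, mul_left_comm (g ^ _)]
    exact mul_le_mul_right (hy.lintegral_le hr hD hQ) _
  · simp [hy]

/-- The events `IsSeparated r x (· ∈ I)`, into which resampling leads, overlap at most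
`2 ^ Fintype.card τ` times. -/
theorem lintegral_exists_isSplittableCluster_le [SigmaFinite μ] [Std.Symm r] {τ : Type*}
    [Fintype τ] [DecidableEq ι] (hr : Measurable fun e : E × E => r e.1 e.2) {cell : E → τ}
    (hcell : ∀ u v, cell u = cell v → r u v) (N : ℕ) (hg : g ≤ 1) (hQ : 1 ≤ Q) :
    g ^ N * (Q * ∫⁻ x in {x | ∃ I : Finset ι, I.card < N ∧ IsSplittableCluster r μ g x (· ∈ I)},
      Q ^ clusterCount r x ∂Measure.pi fun _ : ι => μ) ≤
        2 ^ Fintype.card τ * ∫⁻ x, Q ^ clusterCount r x ∂Measure.pi fun _ : ι => μ := by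
  classical
  let A : Finset ι → Set (ι → E) := fun I => {x | I.card < N ∧ IsSplittableCluster r μ g x (· ∈ I)}
  let B : Finset ι → Set (ι → E) := fun I => {x | IsSeparated r x (· ∈ I)}
  have hB : ∀ I, MeasurableSet (B I) := fun I => (measurable_isSeparated hr _).setOf
  have resampled : ∀ I, g ^ N * (Q * ∫⁻ x in A I, Q ^ clusterCount r x ∂Measure.pi fun _ => μ) ≤
      ∫⁻ x in B I, Q ^ clusterCount r x ∂Measure.pi fun _ => μ := fun I => by
    by_cases hI : I.card < N
    · refine le_trans ?_ (lintegral_isSplittableCluster_le hr g hQ (· ∈ I))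
      simp only [A, hI, true_and]
      gcongr ?_ * _
      exact pow_le_pow_of_le_one zero_le hg (by simpa using hI.le)
    · simp [A, hI]
  calc _ ≤ g ^ N * (Q * ∑ I, ∫⁻ x in A I, Q ^ clusterCount r x ∂Measure.pi fun _ => μ) := by
        gcongr
        rw [ofPred_exists]
        exact (lintegral_iUnion_le _ _).trans_eq (tsum_fintype _)
    _ = ∑ I, g ^ N * (Q * ∫⁻ x in A I, Q ^ clusterCount r x ∂Measure.pi fun _ => μ) := by
        rw [Finset.mul_sum, Finset.mul_sum]
    _ ≤ ∑ I, ∫⁻ x in B I, Q ^ clusterCount r x ∂Measure.pi fun _ => μ :=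
        Finset.sum_le_sum fun I _ => resampled I
    _ = ∫⁻ x, ∑ I, (B I).indicator (fun x => Q ^ clusterCount r x) x ∂Measure.pi fun _ => μ := by
        rw [lintegral_finsetSum _ fun I _ => (measurable_pow_clusterCount hr Q).indicator (hB I)]
        simp only [lintegral_indicator (hB _)]
    _ ≤ ∫⁻ x, 2 ^ Fintype.card τ * Q ^ clusterCount r x ∂Measure.pi fun _ => μ := by
        refine lintegral_mono fun x => ?_
        simp only [indicator_apply, B, mem_ofPred_eq]
        rw [← Finset.sum_filter, Finset.sum_const, nsmul_eq_mul]
        gcongr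
        exact_mod_cast card_isSeparated_le hcell x fun I hI => (Finset.mem_filter.1 hI).2
    _ = _ := lintegral_const_mul _ (measurable_pow_clusterCount hr Q)

end Resampling

section Injective

variable {E ι : Type*} [MeasurableSpace E] [Fintype ι]

theorem measure_pi_setOf_apply_eq [MeasurableEq E] (μ : Measure E) [SigmaFinite μ]
    [NullSingletonClass μ] {i j : ι} (hij : i ≠ j) :
    Measure.pi (fun _ : ι => μ) {x | x i = x j} = 0 := by
  classical
  let s : Set (({k // k ≠ i} → E) × ({k // ¬ k ≠ i} → E)) :=
    {yc | yc.2 ⟨i, by simp⟩ = yc.1 ⟨j, hij.symm⟩}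
  have hs : MeasurableSet s := measurableSet_eq_fun
    ((measurable_pi_apply _).comp measurable_snd) ((measurable_pi_apply _).comp measurable_fst)
  refine ((measurePreserving_piEquivPiSubtypeProd (fun _ => μ) (· ≠ i)).measure_preimage
    hs.nullMeasurableSet).trans ?_
  rw [Measure.prod_apply hs, lintegral_eq_zero_iff (measurable_measure_prodMk_left hs)]
  exact .of_forall fun y => Measure.pi_hyperplane _ _ _

theorem ae_injective [MeasurableEq E] (μ : Measure E) [SigmaFinite μ] [NullSingletonClass μ] :
    ∀ᵐ x ∂Measure.pi fun _ : ι => μ, Function.Injective x := by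
  have : ∀ᵐ x ∂Measure.pi fun _ : ι => μ, ∀ i j : ι, i ≠ j → x i ≠ x j := by
    simp only [ae_all_iff]
    intro i j hij
    simpa [ae_iff] using measure_pi_setOf_apply_eq μ hij
  filter_upwards [this] with x hx i j
  exact not_imp_not.1 (hx i j)

end Injective

section Box

variable {d : ℕ} {a b : Fin d → ℝ}

/-- Two points of the box are near if their distance modulo the box is at most `1`. On distinct
points this is the adjacency relation of `graph`. -/
def Near (u v : box a b) : Prop :=
  perDist u v ≤ 1

instance : Std.Symm (Near (a := a) (b := b)) :=
  ⟨fun u v h => (perDist_comm v u).trans_le h⟩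

theorem measurable_near : Measurable fun e : box a b × box a b => Near e.1 e.2 :=
  measurableSet_setOfPred.1 <| measurableSet_le (Measurable.iInf fun _ =>
    ((measurable_fst.subtype_val.sub measurable_snd.subtype_val).add_const _).norm) measurable_const

theorem perDist_le_dist (u v : box a b) : perDist u v ≤ dist u v := by
  have period_zero : period a b 0 = 0 := by ext i; simp [period]
  refine (ciInf_le ⟨0, ?_⟩ 0).trans_eq ?_
  · rintro _ ⟨k, rfl⟩
    exact norm_nonneg _
  · rw [period_zero, add_zero, Subtype.dist_eq, dist_eq_norm]

theorem isBounded_box (a b : Fin d → ℝ) : Bornology.IsBounded (box a b) := by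
  refine (isCompact_Icc.image (s := Icc a b)
    (EuclideanSpace.equiv (Fin d) ℝ).symm.continuous).isBounded.subset fun x hx => ?_
  exact ⟨EuclideanSpace.equiv (Fin d) ℝ x, ⟨fun i => (hx i).1, fun i => (hx i).2.le⟩, by simp⟩

theorem exists_finite_cells_near (a b : Fin d → ℝ) :
    ∃ (t : Finset (EuclideanSpace ℝ (Fin d))) (cell : box a b → t),
      ∀ u v, cell u = cell v → Near u v := by
  have totallyBounded : TotallyBounded (box a b) :=
    (Bornology.IsBounded.isCompact_closure (isBounded_box a b)).totallyBounded.subset subset_closure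
  obtain ⟨t, ht, hcover⟩ := Metric.totallyBounded_iff.1 totallyBounded (1 / 2) (by norm_num)
  have exists_center : ∀ u : box a b, ∃ y : ht.toFinset, dist u.1 y.1 < 1 / 2 := fun u => by
    obtain ⟨y, hy, h⟩ := mem_iUnion₂.1 (hcover u.2)
    exact ⟨⟨y, ht.mem_toFinset.2 hy⟩, h⟩
  choose cell hcell using exists_center
  refine ⟨_, cell, fun u v huv => (perDist_le_dist u v).trans ?_⟩
  have := dist_triangle_right u.1 v.1 (cell u).1
  have := hcell u
  have := huv ▸ hcell v
  rw [Subtype.dist_eq]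
  linarith

theorem measurableSet_box (a b : Fin d → ℝ) : MeasurableSet (box a b) := by
  simp only [box, ofPred_forall]
  exact .iInter fun i => measurableSet_Ico.preimage (by fun_prop)

theorem lebesgue_apply (S : Set (box a b)) : lebesgue a b S = volume (Subtype.val '' S) :=
  (MeasurableEmbedding.subtype_coe (measurableSet_box a b)).comap_apply _ _

instance isFiniteMeasure_lebesgue (a b : Fin d → ℝ) : IsFiniteMeasure (lebesgue a b) := by
  refine ⟨?_⟩
  rw [lebesgue_apply, image_univ, Subtype.range_val]
  exact Bornology.IsBounded.measure_lt_top (isBounded_box a b)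

instance nullSingletonClass_lebesgue [NeZero d] (a b : Fin d → ℝ) :
    NullSingletonClass (lebesgue a b) :=
  ⟨fun u => by rw [lebesgue_apply, image_singleton, measure_singleton]⟩

theorem isSplittable_freeSpace_of_not_isConfined {κ : Type*} [Fintype κ] [Nontrivial κ] {γ : ℝ}
    {g : ℝ≥0∞} (hg : g ≤ ENNReal.ofReal (γ / 2)) {X C : Finset (box a b)} (hC : 2 ≤ C.card)
    (h : ¬ IsConfined γ X C) : IsSplittable Near (lebesgue a b) g κ (freeSpace X C) := by
  obtain ⟨S, T, -, -, hS, hT, hST, hgS, hgT⟩ := not_not.1 (not_and.1 h hC)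
  have not_near : ∀ u ∈ S, ∀ v ∈ T, ¬ Near u v := fun u hu v hv => by
    have hdist : setDist S T ≤ ENNReal.ofReal (perDist u v) := iInf₂_le_of_le u hu (iInf₂_le v hv)
    simpa [Near] using hST.trans_le hdist
  exact isSplittable_of_subsets hS hT not_near ((mul_le_mul_left hg _).trans hgS)
    ((mul_le_mul_left hg _).trans hgT)

end Box

section Configurations

variable {d n : ℕ} {a b : Fin d → ℝ} {x : Fin n → box a b}

theorem coe_points_ofTuple (x : Fin n → box a b) :
    ((ofTuple n x).points : Set (box a b)) = range x := by
  simp [ofTuple]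

theorem ofTuple_eq_ofTuple_iff {m : ℕ} {y : Fin m → box a b} :
    ofTuple n x = ofTuple m y ↔ range x = range y := by
  rw [ofTuple, ofTuple, Config.mk.injEq, Set.Finite.toFinset_inj]

theorem exists_injective_ofTuple_eq (X : Config a b) :
    ∃ (n : ℕ) (x : Fin n → box a b), Function.Injective x ∧ ofTuple n x = X := by
  refine ⟨_, fun i => (X.points.equivFin.symm i).1,
    Subtype.val_injective.comp (Equiv.injective _), ?_⟩
  obtain ⟨X⟩ := X
  refine congrArg Config.mk (Finset.coe_injective ?_)
  rw [Finite.coe_toFinset, range_comp' Subtype.val, Equiv.range_eq_univ, image_univ]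
  exact Subtype.range_val

theorem measurableSet_config_iff {A : Set (Config a b)} :
    MeasurableSet A ↔ ∀ n, MeasurableSet (ofTuple n ⁻¹' A) := by
  simp only [MeasurableSpace.measurableSet_iInf]
  rfl

theorem measurable_ofTuple (n : ℕ) : Measurable (ofTuple n : (Fin n → box a b) → Config a b) :=
  fun _ hA => measurableSet_config_iff.1 hA n

theorem measurableSet_image_ofTuple {S : Set (Fin n → box a b)} (hS : MeasurableSet S) :
    MeasurableSet (ofTuple n '' S) := by
  refine measurableSet_config_iff.2 fun m => ?_
  have preimage_eq : ofTuple m ⁻¹' (ofTuple n '' S) = {y : Fin m → box a b |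
      ∃ φ : Fin n → Fin m, (fun i => y (φ i)) ∈ S ∧ ∀ j, ∃ i, y (φ i) = y j} := by
    ext y
    constructor
    · rintro ⟨x, hx, hxy⟩
      rw [ofTuple_eq_ofTuple_iff] at hxy
      choose φ hφ using fun i => hxy.subset (mem_range_self i)
      refine ⟨φ, by simpa only [hφ] using hx, fun j => ?_⟩
      simp only [hφ]
      exact hxy.superset (mem_range_self j)
    · rintro ⟨φ, hφ, hrange⟩
      refine ⟨_, hφ, ofTuple_eq_ofTuple_iff.2 (Subset.antisymm ?_ ?_)⟩
      · rintro _ ⟨i, rfl⟩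
        exact mem_range_self _
      · rintro _ ⟨j, rfl⟩
        exact hrange j
  rw [preimage_eq]
  refine Measurable.setOf (.exists fun φ => .and ?_ (.forall fun j => .exists fun i => ?_))
  · exact (measurable_mem.2 hS).comp (measurable_pi_lambda _ fun i => measurable_pi_apply _)
  · exact measurableSet_setOfPred.1
      (measurableSet_eq_fun (measurable_pi_apply _) (measurable_pi_apply _))

theorem measurableSet_injective (n : ℕ) (a b : Fin d → ℝ) :
    MeasurableSet {x : Fin n → box a b | Function.Injective x} :=
  Measurable.setOf <| .forall fun i => .forall fun j => .imp (measurableSet_setOfPred.1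
    (measurableSet_eq_fun (measurable_pi_apply i) (measurable_pi_apply j))) measurable_const

theorem measurable_of_injective_ofTuple {β : Type*} [MeasurableSpace β] {f : Config a b → β}
    {F : ∀ n, (Fin n → box a b) → β} (hF : ∀ n, Measurable (F n))
    (h : ∀ n x, Function.Injective x → f (ofTuple n x) = F n x) : Measurable f := by
  intro s hs
  have preimage_eq : f ⁻¹' s = ⋃ n, ofTuple n '' ({x | Function.Injective x} ∩ F n ⁻¹' s) := by
    ext X
    obtain ⟨n, x, hx, rfl⟩ := exists_injective_ofTuple_eq X
    simp only [mem_preimage, mem_iUnion, mem_image]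
    refine ⟨fun hX => ⟨n, x, ⟨hx, ?_⟩, rfl⟩, ?_⟩
    · rwa [mem_preimage, ← h n x hx]
    · rintro ⟨m, y, ⟨hy, hys⟩, hyx⟩
      rwa [← hyx, h m y hy]
  rw [preimage_eq]
  exact .iUnion fun n =>
    measurableSet_image_ofTuple ((measurableSet_injective n a b).inter (hF n hs))

theorem setLIntegral_lebesguePoisson {f : Config a b → ℝ≥0∞} (hf : Measurable f)
    {A : Set (Config a b)} (hA : MeasurableSet A) :
    ∫⁻ X in A, f X ∂lebesguePoisson a b = ∑' n : ℕ, (n.factorial : ℝ≥0∞)⁻¹ *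
      ∫⁻ x in ofTuple n ⁻¹' A, f (ofTuple n x) ∂Measure.pi fun _ => lebesgue a b := by
  rw [lebesguePoisson, Measure.restrict_sum _ hA, lintegral_sum_measure]
  refine tsum_congr fun n => ?_
  rw [setLIntegral_smul_measure, setLIntegral_map hA hf (measurable_ofTuple n), smul_eq_mul]

/-- As `A` need not be measurable, it is first enlarged to the complement of the configurations
that have an injective enumeration outside of `S`. -/
theorem setLIntegral_lebesguePoisson_le [NeZero d] {f : Config a b → ℝ≥0∞} (hf : Measurable f)
    {A : Set (Config a b)} {S : ∀ n, Set (Fin n → box a b)} (hS : ∀ n, MeasurableSet (S n))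
    (hAS : ∀ n x, Function.Injective x → ofTuple n x ∈ A → x ∈ S n) :
    ∫⁻ X in A, f X ∂lebesguePoisson a b ≤ ∑' n : ℕ, (n.factorial : ℝ≥0∞)⁻¹ *
      ∫⁻ x in S n, f (ofTuple n x) ∂Measure.pi fun _ => lebesgue a b := by
  let B : Set (Config a b) := (⋃ n, ofTuple n '' ({x | Function.Injective x} \ S n))ᶜ
  have hB : MeasurableSet B := .compl <| .iUnion fun n =>
    measurableSet_image_ofTuple ((measurableSet_injective n a b).diff (hS n))
  have hAB : A ⊆ B := fun X hX hmem => by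
    obtain ⟨n, x, ⟨hx, hxS⟩, rfl⟩ := mem_iUnion.1 hmem
    exact hxS (hAS n x hx hX)
  refine (lintegral_mono_set hAB).trans ((setLIntegral_lebesguePoisson hf hB).trans_le ?_)
  refine ENNReal.tsum_le_tsum fun n =>
    mul_le_mul_right (lintegral_mono' (Measure.restrict_mono_ae ?_) le_rfl) _
  filter_upwards [ae_injective (ι := Fin n) (lebesgue a b)] with x hx hxB
  by_contra hxS
  exact hxB (mem_iUnion.2 ⟨n, x, ⟨hx, hxS⟩, rfl⟩)

end Configurations

section ClustersOfConfigurations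

variable {d n : ℕ} {a b : Fin d → ℝ} {x : Fin n → box a b} {γ : ℝ} {N₀ : ℕ} {g : ℝ≥0∞}

/-- The connected components of the graph of `X` are the classes of the points of `X` with respect
to the equivalence relation generated by `Near`. -/
def connectedComponentEquiv (X : Finset (box a b)) :
    (graph X).ConnectedComponent ≃ Quot fun u v : {u // u ∈ X} => Near u.1 v.1 where
  toFun := SimpleGraph.ConnectedComponent.lift (Quot.mk _) fun u v p hp => by
    clear hp
    induction p with
    | nil => rfl
    | cons h _ ih => exact Eq.trans (b := Quot.mk _ _) (Quot.sound h.2) ih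
  invFun := Quot.lift (graph X).connectedComponentMk fun u v huv => by
    by_cases h : u = v
    · rw [h]
    · exact SimpleGraph.ConnectedComponent.sound (SimpleGraph.Adj.reachable ⟨h, huv⟩)
  left_inv := SimpleGraph.ConnectedComponent.ind fun _ => rfl
  right_inv := by rintro ⟨u⟩; rfl

/-- An injective family enumerates its configuration. -/
def pointsEquiv (hx : Function.Injective x) : Fin n ≃ {u // u ∈ (ofTuple n x).points} :=
  (Equiv.ofInjective x hx).trans
    (Equiv.subtypeEquivRight fun u => (Set.ext_iff.1 (coe_points_ofTuple x) u).symm)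

/-- The clusters of an injective family are those of its configuration. -/
def componentEquiv (hx : Function.Injective x) :
    (Quot fun i j => Near (x i) (x j)) ≃ (graph (ofTuple n x).points).ConnectedComponent :=
  (Quot.congr (pointsEquiv hx) fun _ _ => Iff.rfl).trans (connectedComponentEquiv _).symm

theorem card_points_ofTuple (hx : Function.Injective x) : (ofTuple n x).points.card = n := by
  simpa using (Fintype.card_congr (pointsEquiv hx)).symm

theorem numClusters_ofTuple (hx : Function.Injective x) :
    numClusters (ofTuple n x).points = clusterCount Near x :=
  (Nat.card_congr (componentEquiv hx)).symm

theorem IsCluster.exists_quot (hx : Function.Injective x) {C : Finset (box a b)}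
    (hC : IsCluster (ofTuple n x).points C) :
    ∃ c : Quot fun i j => Near (x i) (x j), ∀ i, x i ∈ C ↔ Quot.mk _ i = c := by
  obtain ⟨c, hc⟩ := hC
  refine ⟨(componentEquiv hx).symm c, fun i => ?_⟩
  rw [Equiv.eq_symm_apply, ← Finset.mem_coe, hc]
  exact Subtype.val_injective.mem_set_image (a := pointsEquiv hx i)

theorem IsCluster.nonempty {X C : Finset (box a b)} (hC : IsCluster X C) : C.Nonempty := by
  obtain ⟨c, hc⟩ := hC
  rw [← Finset.coe_nonempty, hc]
  exact c.nonempty_supp.image _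

theorem IsCluster.subset {X C : Finset (box a b)} (hC : IsCluster X C) : C ⊆ X := by
  obtain ⟨c, hc⟩ := hC
  intro u hu
  obtain ⟨v, -, rfl⟩ := hc.subset hu
  exact v.2

theorem freeSpace_ofTuple (x : Fin n → box a b) {C : Finset (box a b)} {p : Fin n → Prop}
    (hp : ∀ i, p i ↔ x i ∈ C) :
    freeSpace (ofTuple n x).points C = freeOf Near (Subtype.restrict (¬ p ·) x) := by
  ext u
  simp only [freeSpace, occupied, freeOf, Near, coe_points_ofTuple, mem_compl_iff, mem_ofPred_eq,
    mem_sdiff, Finset.mem_coe, not_exists, not_and, and_imp, forall_mem_range, hp, Subtype.forall,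
    Subtype.restrict_apply]

theorem exists_isSplittableCluster (hg : g ≤ ENNReal.ofReal (γ / 2)) (hx : Function.Injective x)
    (h : ofTuple n x ∉ disordered a b γ ∪ ordered a b N₀) :
    ∃ I : Finset (Fin n), I.card < N₀ ∧
      IsSplittableCluster Near (lebesgue a b) g x (· ∈ I) := by
  classical
  simp only [mem_union, not_or, disordered, ordered, mem_ofPred_eq, not_forall, not_exists,
    not_and, not_le] at h
  obtain ⟨⟨C, hC, hne, hconf⟩, hsmall⟩ := h
  let I : Finset (Fin n) := Finset.univ.filter (x · ∈ C)
  have mem_I : ∀ i, i ∈ I ↔ x i ∈ C := by simp [I]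
  have image_I : I.image x = C := by
    ext u
    simp only [Finset.mem_image, mem_I]
    refine ⟨by rintro ⟨i, hi, rfl⟩; exact hi, fun hu => ?_⟩
    obtain ⟨i, rfl⟩ := (coe_points_ofTuple x).subset (hC.subset hu)
    exact ⟨i, hu, rfl⟩
  have card_I : I.card = C.card := image_I ▸ (Finset.card_image_of_injective I hx).symm
  have two_le : 2 ≤ C.card := by
    have := hC.nonempty.card_pos
    omega
  obtain ⟨c, hc⟩ := hC.exists_quot hx
  replace hc : ∀ i, i ∈ I ↔ Quot.mk _ i = c := fun i => (mem_I i).trans (hc i)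
  have : Nontrivial {i // i ∈ I} :=
    (Finset.one_lt_card_iff_nontrivial.1 (by omega)).coe_sort
  have splittable :=
    isSplittable_freeSpace_of_not_isConfined (κ := {i // i ∈ I}) hg two_le hconf
  rw [freeSpace_ofTuple x mem_I] at splittable
  refine ⟨I, card_I.trans_lt (hsmall C hC), isSeparated_of_quot hc,
    clusterCount_restrict_eq_one hc, ?_⟩
  convert splittable

end ClustersOfConfigurations

section RandomCluster

variable {d n : ℕ} {a b : Fin d → ℝ} {q z : ℝ} {g : ℝ≥0∞}

theorem measurable_weight (q z : ℝ) : Measurable (weight q z : Config a b → ℝ≥0∞) := by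
  refine measurable_of_injective_ofTuple
    (F := fun n x => ENNReal.ofReal (z ^ n * q ^ clusterCount Near x))
    (fun n => ?_) fun n x hx => ?_
  · exact (measurable_of_countable fun k : ℕ => ENNReal.ofReal (z ^ n * q ^ k)).comp
      (measurable_clusterCount measurable_near)
  · rw [weight, card_points_ofTuple hx, numClusters_ofTuple hx]

theorem weight_ofTuple {x : Fin n → box a b} (hx : Function.Injective x) (hq : 0 ≤ q)
    (hz : 0 ≤ z) : weight q z (ofTuple n x) =
      ENNReal.ofReal z ^ n * ENNReal.ofReal q ^ clusterCount Near x := by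
  rw [weight, card_points_ofTuple hx, numClusters_ofTuple hx, ENNReal.ofReal_mul (by positivity),
    ENNReal.ofReal_pow hz, ENNReal.ofReal_pow hq]

theorem setLIntegral_weight_ofTuple [NeZero d] (hq : 0 ≤ q) (hz : 0 ≤ z)
    (S : Set (Fin n → box a b)) :
    ∫⁻ x in S, weight q z (ofTuple n x) ∂(Measure.pi fun _ => lebesgue a b) =
      ENNReal.ofReal z ^ n *
        ∫⁻ x in S, ENNReal.ofReal q ^ clusterCount Near x ∂Measure.pi fun _ => lebesgue a b := by
  rw [← lintegral_const_mul _ (measurable_pow_clusterCount measurable_near _)]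
  refine lintegral_congr_ae (ae_restrict_of_ae ?_)
  filter_upwards [ae_injective (lebesgue a b)] with x hx
  exact weight_ofTuple hx hq hz

theorem partitionFunction_eq [NeZero d] (a b : Fin d → ℝ) (hq : 0 ≤ q) (hz : 0 ≤ z) :
    partitionFunction a b q z = ∑' n : ℕ, (n.factorial : ℝ≥0∞)⁻¹ * (ENNReal.ofReal z ^ n *
      ∫⁻ x : Fin n → box a b, ENNReal.ofReal q ^ clusterCount Near x
        ∂Measure.pi fun _ => lebesgue a b) := by
  rw [partitionFunction, ← setLIntegral_univ,
    setLIntegral_lebesguePoisson (measurable_weight q z) .univ]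
  refine tsum_congr fun n => congrArg _ ?_
  rw [preimage_univ, setLIntegral_weight_ofTuple hq hz, setLIntegral_univ]

theorem partitionFunction_ne_zero [NeZero d] (a b : Fin d → ℝ) (hq : 0 ≤ q) (hz : 0 ≤ z) :
    partitionFunction a b q z ≠ 0 := by
  have no_clusters (x : Fin 0 → box a b) : clusterCount Near x = 0 := by
    simpa using clusterCount_le_card Near x
  rw [partitionFunction_eq a b hq hz]
  refine (lt_of_lt_of_le ?_ (ENNReal.le_tsum 0)).ne'
  simp [no_clusters]

theorem partitionFunction_ne_top [NeZero d] (a b : Fin d → ℝ) (hq : 1 ≤ q) (hz : 0 ≤ z) :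
    partitionFunction a b q z ≠ ∞ := by
  set t : ℝ := z * (q * (lebesgue a b).real univ)
  have term_le (n : ℕ) : (n.factorial : ℝ≥0∞)⁻¹ * (ENNReal.ofReal z ^ n *
      ∫⁻ x : Fin n → box a b, ENNReal.ofReal q ^ clusterCount Near x
        ∂Measure.pi fun _ => lebesgue a b) ≤ ENNReal.ofReal (t ^ n / n.factorial) := by
    calc _ ≤ (n.factorial : ℝ≥0∞)⁻¹ * (ENNReal.ofReal z ^ n *
          ∫⁻ _ : Fin n → box a b, ENNReal.ofReal q ^ n ∂Measure.pi fun _ => lebesgue a b) := by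
          gcongr with x
          · exact ENNReal.one_le_ofReal.2 hq
          · simpa using clusterCount_le_card Near x
      _ = (n.factorial : ℝ≥0∞)⁻¹ * ENNReal.ofReal (t ^ n) := by
          rw [lintegral_const, Measure.pi_univ, Finset.prod_const, Finset.card_univ,
            Fintype.card_fin, ← mul_pow, ← mul_pow, ENNReal.ofReal_pow (by positivity),
            ENNReal.ofReal_mul hz, ENNReal.ofReal_mul (by positivity), ofReal_measureReal]
      _ = _ := by
          rw [ENNReal.ofReal_div_of_pos (by positivity), ENNReal.ofReal_natCast,
            ENNReal.div_eq_inv_mul]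
  rw [partitionFunction_eq a b (by positivity) hz]
  refine ne_top_of_le_ne_top ?_ (ENNReal.tsum_le_tsum term_le)
  rw [← ENNReal.ofReal_tsum_of_nonneg (fun n => by positivity) (Real.summable_pow_div_factorial t)]
  exact ENNReal.ofReal_ne_top

theorem isProbabilityMeasure_randomCluster [NeZero d] (a b : Fin d → ℝ) (hq : 1 ≤ q)
    (hz : 0 ≤ z) : IsProbabilityMeasure (randomCluster a b q z) := by
  refine ⟨?_⟩
  rw [randomCluster, Measure.smul_apply, withDensity_apply _ .univ, setLIntegral_univ, smul_eq_mul]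
  exact ENNReal.inv_mul_cancel (partitionFunction_ne_zero a b (by positivity) hz)
    (partitionFunction_ne_top a b hq hz)

theorem setLIntegral_weight_compl_le [NeZero d] {γ : ℝ} {τ : Type*} [Fintype τ]
    {cell : box a b → τ} (hcell : ∀ u v, cell u = cell v → Near u v) (N₀ : ℕ) (hg : g ≤ 1)
    (hgγ : g ≤ ENNReal.ofReal (γ / 2)) (hq : 1 ≤ q) (hz : 0 ≤ z) :
    g ^ N₀ * ENNReal.ofReal q * ∫⁻ X in (disordered a b γ ∪ ordered a b N₀)ᶜ,
      weight q z X ∂lebesguePoisson a b ≤ 2 ^ Fintype.card τ * partitionFunction a b q z := by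
  let S (n : ℕ) : Set (Fin n → box a b) :=
    {x | ∃ I : Finset (Fin n), I.card < N₀ ∧ IsSplittableCluster Near (lebesgue a b) g x (· ∈ I)}
  have hS (n : ℕ) : MeasurableSet (S n) := Measurable.setOf <| .exists fun I =>
    measurable_const.and (measurable_isSplittableCluster measurable_near g _)
  have hq₀ : 0 ≤ q := by positivity
  have tuples_le := setLIntegral_lebesguePoisson_le (measurable_weight q z)
    (A := (disordered a b γ ∪ ordered a b N₀)ᶜ) hS
    (fun n x hx h => exists_isSplittableCluster hgγ hx h)
  rw [partitionFunction_eq a b hq₀ hz, ← ENNReal.tsum_mul_left]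
  refine (mul_le_mul_right tuples_le _).trans ?_
  rw [← ENNReal.tsum_mul_left]
  refine ENNReal.tsum_le_tsum fun n => ?_
  rw [setLIntegral_weight_ofTuple hq₀ hz]
  have resampled := lintegral_exists_isSplittableCluster_le (μ := lebesgue a b) (ι := Fin n)
    measurable_near hcell N₀ hg (ENNReal.one_le_ofReal.2 hq)
  calc _ = (n.factorial : ℝ≥0∞)⁻¹ * (ENNReal.ofReal z ^ n * (g ^ N₀ * (ENNReal.ofReal q *
        ∫⁻ x in S n, ENNReal.ofReal q ^ clusterCount Near x
          ∂Measure.pi fun _ => lebesgue a b))) := by ring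
    _ ≤ _ := mul_le_mul_right (mul_le_mul_right resampled _) _
    _ = _ := by ring

theorem randomCluster_compl_le [NeZero d] {γ : ℝ} {τ : Type*} [Fintype τ]
    {cell : box a b → τ} (hcell : ∀ u v, cell u = cell v → Near u v) (N₀ : ℕ) (hg : g ≤ 1)
    (hgγ : g ≤ ENNReal.ofReal (γ / 2)) (hq : 1 ≤ q) (hz : 0 ≤ z) :
    g ^ N₀ * ENNReal.ofReal q *
      randomCluster a b q z (disordered a b γ ∪ ordered a b N₀)ᶜ ≤ 2 ^ Fintype.card τ := by
  have : SFinite (lebesguePoisson a b) := by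
    unfold lebesguePoisson
    infer_instance
  rw [randomCluster, Measure.smul_apply, withDensity_apply', smul_eq_mul, mul_left_comm,
    ← ENNReal.div_eq_inv_mul]
  exact ENNReal.div_le_of_le_mul (setLIntegral_weight_compl_le hcell N₀ hg hgγ hq hz)

theorem exists_randomCluster_compl_le [NeZero d] (a b : Fin d → ℝ) {γ ε : ℝ} (hγ : 0 < γ) (N₀ : ℕ)
    (hε : 0 < ε) : ∃ q₀ : ℝ, 1 ≤ q₀ ∧ ∀ q : ℝ, q₀ ≤ q → ∀ z : ℝ, 0 ≤ z →
      randomCluster a b q z (disordered a b γ ∪ ordered a b N₀)ᶜ ≤ ENNReal.ofReal ε := by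
  obtain ⟨t, cell, hcell⟩ := exists_finite_cells_near a b
  let g : ℝ := min (γ / 2) 1
  have hg : 0 < g := lt_min (half_pos hγ) one_pos
  refine ⟨max 1 (2 ^ Fintype.card t / (g ^ N₀ * ε)), le_max_left _ _, fun q hq z hz => ?_⟩
  obtain ⟨hq₁, hq₂⟩ := max_le_iff.1 hq
  have scaled_le := randomCluster_compl_le hcell N₀
    (ENNReal.ofReal_le_one.2 (min_le_right (γ / 2) 1))
    (ENNReal.ofReal_le_ofReal (min_le_left (γ / 2) 1)) hq₁ hz
  have cells_le : (2 : ℝ≥0∞) ^ Fintype.card t ≤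
      ENNReal.ofReal g ^ N₀ * ENNReal.ofReal q * ENNReal.ofReal ε := by
    have := (div_le_iff₀ (by positivity)).1 hq₂
    rw [← ENNReal.ofReal_pow hg.le, ← ENNReal.ofReal_mul (by positivity),
      ← ENNReal.ofReal_mul (by positivity), ← ENNReal.ofReal_ofNat,
      ← ENNReal.ofReal_pow zero_le_two]
    exact ENNReal.ofReal_le_ofReal (this.trans_eq (by ring))
  refine (ENNReal.mul_le_mul_iff_right ?_ (by finiteness)).1 (scaled_le.trans cells_le)
  exact mul_ne_zero (pow_ne_zero _ (ENNReal.ofReal_pos.2 hg).ne')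
    (ENNReal.ofReal_pos.2 (by positivity)).ne'

end RandomCluster

end WidomRowlinson

end

open WidomRowlinson in
theorem mainTheorem2_general (d : ℕ) [NeZero d] (a b : Fin d → ℝ) (γ : ℝ) (hγ : 0 < γ) (N₀ : ℕ)
    (ε : ℝ) (hε : 0 < ε) :
    ∃ q₀ : ℝ, 1 ≤ q₀ ∧ ∀ q : ℝ, q₀ ≤ q → ∀ z : ℝ, 0 ≤ z →
      IsProbabilityMeasure (randomCluster a b q z) ∧
      ENNReal.ofReal (1 - ε) ≤ randomCluster a b q z (disordered a b γ ∪ ordered a b N₀) ∧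
      randomCluster a b q z (disordered a b γ ∪ ordered a b N₀)ᶜ ≤ ENNReal.ofReal ε := by
  obtain ⟨q₀, hq₀, compl_le⟩ := exists_randomCluster_compl_le a b hγ N₀ hε
  refine ⟨q₀, hq₀, fun q hq z hz => ?_⟩
  have hprob := isProbabilityMeasure_randomCluster a b (hq₀.trans hq) hz
  refine ⟨hprob, ?_, compl_le q hq z hz⟩
  rw [ENNReal.ofReal_sub _ hε.le, ENNReal.ofReal_one, tsub_le_iff_right]
  calc 1 = randomCluster a b q z univ := measure_univ.symm
    _ ≤ randomCluster a b q z (disordered a b γ ∪ ordered a b N₀) +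
        randomCluster a b q z (disordered a b γ ∪ ordered a b N₀)ᶜ := by
      rw [← union_compl_self (disordered a b γ ∪ ordered a b N₀)]
      exact measure_union_le _ _
    _ ≤ _ := by gcongr; exact compl_le q hq z hz

theorem mainTheorem2 (d : ℕ) (hd : 2 ≤ d) (a b : Fin d → ℝ) (hab : ∀ i, a i < b i)
    (γ : ℝ) (hγ0 : 0 < γ) (hγ1 : γ < 1) (N₀ : ℕ) (ε : ℝ) (hε : 0 < ε) :
    ∃ q₀ : ℝ, 1 ≤ q₀ ∧ ∀ q : ℝ, q₀ ≤ q → ∀ z : ℝ, 0 < z →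
      MeasureTheory.IsProbabilityMeasure (WidomRowlinson.randomCluster a b q z) ∧
      ENNReal.ofReal (1 - ε) ≤ WidomRowlinson.randomCluster a b q z
        (WidomRowlinson.disordered a b γ ∪ WidomRowlinson.ordered a b N₀) ∧
      WidomRowlinson.randomCluster a b q z
        (WidomRowlinson.disordered a b γ ∪ WidomRowlinson.ordered a b N₀)ᶜ ≤
          ENNReal.ofReal ε := by
  have : NeZero d := ⟨by lia⟩
  exact (mainTheorem2_general d a b γ hγ0 N₀ ε hε).imp fun _ h =>
    ⟨h.1, fun q hq z hz => h.2 q hq z hz.le⟩
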